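/- Let $n\ge 1$, $\mu\in\mathbb R^n$, let $\Sigma\in\mathbb R^{n\times n}$ be symmetric positive semidefinite with eigenvalues $\lambda_1,\dots,\lambda_n$ (with multiplicities), and let $\sigma\ge 0$, $\varepsilon>0$, $0<p<1$. Let $\chi^2_n(p)$ be the $p$-quantile of the chi-squared distribution with $n$ degrees of freedom. Let $x\sim\mathcal N(\mu,\Sigma)$ be a signal in $\mathbb R^n$ and let $w_0,w_1,w_2,\dots\sim\mathcal N(0,\sigma^2 I_n)$ be noise vectors such that $x,w_0,w_1,\dots$ are independent. The noise is added prior to the measurement: measurement number $t$ with a vector $a$ returns $y_t=a^{\top}(x+w_t)$. Consider the following algorithm. It starts with $\mu_0=\mu$, $\Sigma_0=\Sigma$. For $t=0,1,2,\dots$: if the spectral norm satisfies $\|\Sigma_t\|\le\varepsilon^2/\chi^2_n(p)$, it stops and returns $\widehat x=\mu_t$. Otherwise it takes a unit eigenvector $a_t$ of $\Sigma_t$ for its largest eigenvalue $\|\Sigma_t\|$ (chosen by an arbitrary rule depending only on $t$ and $\Sigma_t$), measures $y_t=a_t^{\top}(x+w_t)$, and sets $$\mu_{t+1}=\mu_t+\Sigma_t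 a_t\,(a_t^{\top}\Sigma_t a_t+\sigma^2)^{-1}(y_t-a_t^{\top}\mu_t),\qquad \Sigma_{t+1}=\Sigma_t-\Sigma_t a_t\,(a_t^{\top}\Sigma_t a_t+\sigma^2)^{-1}a_t^{\top}\Sigma_t .$$ Then the algorithm stops after a finite, non-random number $T$ of measurements, all of them made with unit vectors, and its output satisfies $$\mathbb P\bigl(\|x-\widehat x\|_2<\varepsilon\bigr)\ge p .$$ If $\sigma>0$, then $$T\;\le\;\sum_{i:\,\lambda_i\ne 0}\max\Bigl\{0,\Bigl\lceil\Bigl(\frac{\chi^2_n(p)}{\varepsilon^2}-\frac1{\lambda_i}\Bigr)\sigma^2\Bigr\rceil\Bigr\}.$$ If $\sigma^2\le\varepsilon^2/\chi^2_n(p)$ (in particular if $\sigma=0$), then $$T\;\le\;\#\{i:\lambda_i>\varepsilon^2/\chi^2_n(p)\},$$ and if in addition $\sigma>0$, then the sum above is equal to this cardinality. -/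

import Mathlib

open MeasureTheory ProbabilityTheory
open scoped Matrix

namespace InfoGreedy

/-- The chi-squared distribution with `n` degrees of freedom: the law of the sum of the squares
of `n` independent standard normal variables. -/
noncomputable def chiSq (n : ℕ) : Measure ℝ :=
  (Measure.pi (fun _ : Fin n => gaussianReal 0 1)).map (fun z => ∑ i, z i ^ 2)

/-- The quantile function of the chi-squared distribution with `n` degrees of freedom. -/
noncomputable def chiSqQuantile (n : ℕ) (p : ℝ) : ℝ :=
  sInf {t : ℝ | p ≤ cdf (chiSq n) t}

/-- The spectral norm of a matrix, i.e. its operator norm for the Euclidean norm. -/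
noncomputable def specNorm {n : ℕ} (S : Matrix (Fin n) (Fin n) ℝ) : ℝ :=
  ‖Matrix.toEuclideanCLM (n := Fin n) (𝕜 := ℝ) S‖

/-- `u` is a unit eigenvector of `S` for the eigenvalue `‖S‖` (the largest eigenvalue of `S` when
`S` is positive semidefinite). -/
def IsTopEigenvector {n : ℕ} (S : Matrix (Fin n) (Fin n) ℝ) (u : EuclideanSpace ℝ (Fin n)) :
    Prop :=
  ‖u‖ = 1 ∧ S *ᵥ u.ofLp = specNorm S • u.ofLp

/-- The pair of variables (current mean, current covariance) maintained by the algorithm. -/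
structure State (n : ℕ) where
  mean : EuclideanSpace ℝ (Fin n)
  cov : Matrix (Fin n) (Fin n) ℝ

/-- The update after a measurement with vector `a` and outcome `y`, for noise variance `v`:
`μ ← μ + Σ a (aᵀ Σ a + v)⁻¹ (y - aᵀ μ)` and `Σ ← Σ - Σ a (aᵀ Σ a + v)⁻¹ aᵀ Σ`. -/
noncomputable def State.update {n : ℕ} (v : ℝ) (a : EuclideanSpace ℝ (Fin n)) (y : ℝ)
    (s : State n) : State n where
  mean := s.mean + ((a.ofLp ⬝ᵥ (s.cov *ᵥ a.ofLp) + v)⁻¹ * (y - inner ℝ a s.mean)) •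
    WithLp.toLp 2 (s.cov *ᵥ a.ofLp)
  cov := s.cov - (a.ofLp ⬝ᵥ (s.cov *ᵥ a.ofLp) + v)⁻¹ •
    Matrix.vecMulVec (s.cov *ᵥ a.ofLp) (a.ofLp ᵥ* s.cov)

/-- The variables of the loop after `t` measurements. The rule `u` chooses, from the number of
measurements made so far and the current covariance, the next measurement vector, and `obs t a` is
the outcome of the measurement number `t` if it is made with the vector `a`. -/
noncomputable def loop {n : ℕ} (v : ℝ)
    (u : ℕ → Matrix (Fin n) (Fin n) ℝ → EuclideanSpace ℝ (Fin n))
    (obs : ℕ → EuclideanSpace ℝ (Fin n) → ℝ) (s₀ : State n) : ℕ → State n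
  | 0 => s₀
  | t + 1 =>
    let s := loop v u obs s₀ t
    let a := u t s.cov
    s.update v a (obs t a)

/-- The stopping threshold `ε² / χ²_n(p)` for the spectral norm of the covariance. -/
noncomputable def threshold (n : ℕ) (ε p : ℝ) : ℝ := ε ^ 2 / chiSqQuantile n p

/-- The loop stops after exactly `T` measurements: `T` is the first number of measurements for
which all eigenvalues of the current covariance are at most the threshold. -/
def StopsAfter {n : ℕ} (δ : ℝ) (states : ℕ → State n) (T : ℕ) : Prop :=
  IsLeast {t | specNorm (states t).cov ≤ δ} T

/-- Measurements with noise added prior to the measurement: `y_t = aᵀ (x + w_t)`. -/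
noncomputable def noiseFolding {n : ℕ} (x : EuclideanSpace ℝ (Fin n))
    (w : ℕ → EuclideanSpace ℝ (Fin n)) (t : ℕ) (a : EuclideanSpace ℝ (Fin n)) : ℝ :=
  inner ℝ a (x + w t)

/-- The loop run on the signal `x` with prior mean `μ` and prior covariance `S`, for the noise
vectors `w 0, w 1, …` of variance `σ ^ 2` added prior to the measurement. -/
noncomputable def run {n : ℕ} (σ : ℝ)
    (u : ℕ → Matrix (Fin n) (Fin n) ℝ → EuclideanSpace ℝ (Fin n))
    (μ : EuclideanSpace ℝ (Fin n)) (S : Matrix (Fin n) (Fin n) ℝ)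
    (x : EuclideanSpace ℝ (Fin n)) (w : ℕ → EuclideanSpace ℝ (Fin n)) : ℕ → State n :=
  loop (σ ^ 2) u (noiseFolding x w) ⟨μ, S⟩

/-- `∑_{λ_i ≠ 0} max {0, ⌈(χ²_n(p) / ε² - 1 / λ_i) σ²⌉}`. -/
noncomputable def noisyCount {n : ℕ} (σ ε p : ℝ) (eig : Fin n → ℝ) : ℤ :=
  ∑ i with eig i ≠ 0, max 0 ⌈(chiSqQuantile n p / ε ^ 2 - 1 / eig i) * σ ^ 2⌉

/-- The number of indices `i` with `λ_i > ε² / χ²_n(p)`. -/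
noncomputable def exactCount {n : ℕ} (ε p : ℝ) (eig : Fin n → ℝ) : ℕ :=
  (Finset.univ.filter fun i => threshold n ε p < eig i).card

end InfoGreedy

/-! The covariances never involve the outcomes, so `covAfter` is a deterministic recursion and the
stopping time is non-random. Measuring along a unit eigenvector with eigenvalue `l` replaces `l` by
`l * v / (l + v)`, where `v = σ ^ 2`, and leaves the rest of the spectrum alone. For `v > 0` this
adds `1 / v` to the inverse eigenvalue, so `⌈(1 / δ - 1 / l) * v⌉` measurements bring `l` down to
the threshold `δ`; if `v ≤ δ`, one is enough. A function `f` that drops by one at each such move,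
summed over the spectrum, is therefore a counter of the remaining measurements (`le_spectralSum`);
both bounds and termination are instances.

For the accuracy, the error `x - μ_t` is a linear image of the previous error plus a linear image of
the fresh noise `w_t`. These are independent, and the Joseph form of the update identifies the
resulting covariance as `Σ_{t+1}`; hence the error is centred Gaussian with covariance `Σ_t`
(`hasLaw_run_error`). At the stopping time its squared norm is dominated by `δ` times a chi-squared
variable. -/

namespace InfoGreedy

/-! ### Spectrum under a rank-one change along an eigenvector -/

section Deflation

variable {n : ℕ}

open Polynomial in
/-- Subtracting a multiple of the projection onto a unit eigenvector moves one eigenvalue. -/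
lemma charpoly_sub_smul_vecMulVec_self {M : Matrix (Fin n) (Fin n) ℝ} {a : Fin n → ℝ} {l : ℝ}
    (ha : a ⬝ᵥ a = 1) (hM : M *ᵥ a = l • a) (c : ℝ) :
    (M - c • Matrix.vecMulVec a a).charpoly * (X - C l) = M.charpoly * (X - C (l - c)) := by
  -- Comparing values at `t ≠ l` suffices; there `(t - M) a = (t - l) a` lets `t - M` be factored
  -- out, and the matrix determinant lemma computes the other factor.
  refine Polynomial.eq_of_infinite_eval_eq _ _
    (Set.Infinite.mono ?_ (Set.finite_singleton l).infinite_compl)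
  intro t ht
  have ht' : t - l ≠ 0 := sub_ne_zero.2 ht
  have hdet : (1 + Matrix.vecMulVec ((c / (t - l)) • a) a).det = 1 + c / (t - l) := by
    rw [Matrix.vecMulVec_eq Unit, Matrix.det_one_add_replicateCol_mul_replicateRow,
      dotProduct_smul, ha, smul_eq_mul, mul_one]
  have hmul : Matrix.scalar (Fin n) t - (M - c • Matrix.vecMulVec a a) =
      (Matrix.scalar (Fin n) t - M) * (1 + Matrix.vecMulVec ((c / (t - l)) • a) a) := by
    have hv : (Matrix.scalar (Fin n) t - M) *ᵥ ((c / (t - l)) • a) = c • a := by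
      rw [Matrix.mulVec_smul, Matrix.sub_mulVec, hM, Matrix.scalar_apply,
        ← Matrix.smul_one_eq_diagonal, Matrix.smul_mulVec, Matrix.one_mulVec, ← sub_smul,
        smul_smul, div_mul_cancel₀ _ ht']
    rw [mul_add, mul_one, Matrix.mul_vecMulVec, hv, Matrix.smul_vecMulVec]
    abel
  simp only [Set.mem_ofPred_eq, eval_mul, Matrix.eval_charpoly, eval_sub, eval_X, eval_C, hmul,
    Matrix.det_mul, hdet]
  field_simp
  ring

/-- The sum of `f` over the eigenvalues of a matrix, with multiplicities. -/
noncomputable def spectralSum (f : ℝ → ℕ) (M : Matrix (Fin n) (Fin n) ℝ) : ℕ :=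
  (M.charpoly.roots.map f).sum

lemma spectralSum_eq_sum_eigenvalues (f : ℝ → ℕ) {M : Matrix (Fin n) (Fin n) ℝ}
    (hM : M.IsHermitian) : spectralSum f M = ∑ i, f (hM.eigenvalues i) := by
  rw [spectralSum, hM.roots_charpoly_eq_eigenvalues, Multiset.map_map]
  rfl

lemma spectralSum_sub_smul_vecMulVec_self (f : ℝ → ℕ) {M : Matrix (Fin n) (Fin n) ℝ}
    {a : Fin n → ℝ} {l : ℝ} (ha : a ⬝ᵥ a = 1) (hM : M *ᵥ a = l • a) (c : ℝ) :
    spectralSum f (M - c • Matrix.vecMulVec a a) + f l = spectralSum f M + f (l - c) := by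
  have h := congrArg (fun P => (P.roots.map f).sum) (charpoly_sub_smul_vecMulVec_self ha hM c)
  have hne (N : Matrix (Fin n) (Fin n) ℝ) (r : ℝ) :
      N.charpoly * (Polynomial.X - Polynomial.C r) ≠ 0 :=
    mul_ne_zero N.charpoly_monic.ne_zero (Polynomial.X_sub_C_ne_zero r)
  simpa only [spectralSum, Polynomial.roots_mul (hne _ _), Polynomial.roots_X_sub_C, Multiset.map_add,
    Multiset.sum_add, Multiset.map_singleton, Multiset.sum_singleton] using h

end Deflation

/-! ### The deterministic covariance recursion -/

section Covariance

variable {n : ℕ}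

lemma dotProduct_self_of_norm_eq_one {a : EuclideanSpace ℝ (Fin n)} (ha : ‖a‖ = 1) :
    a.ofLp ⬝ᵥ a.ofLp = 1 := by
  have h := EuclideanSpace.real_norm_sq_eq a
  rw [ha, one_pow] at h
  rw [h, dotProduct]
  exact Finset.sum_congr rfl fun i _ => (sq _).symm

lemma vecMul_eq_mulVec_of_isHermitian {S : Matrix (Fin n) (Fin n) ℝ} (hS : S.IsHermitian)
    (a : Fin n → ℝ) : a ᵥ* S = S *ᵥ a := by
  conv_lhs => rw [← hS.eq]
  rw [Matrix.conjTranspose_eq_transpose_of_trivial, Matrix.vecMul_transpose]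

/-- The gain vector `Σ a (aᵀ Σ a + v)⁻¹`. -/
noncomputable def gain (v : ℝ) (a : Fin n → ℝ) (S : Matrix (Fin n) (Fin n) ℝ) : Fin n → ℝ :=
  (a ⬝ᵥ (S *ᵥ a) + v)⁻¹ • (S *ᵥ a)

/-- The updated covariance `Σ - Σ a (aᵀ Σ a + v)⁻¹ aᵀ Σ`. -/
noncomputable def covUpdate (v : ℝ) (a : Fin n → ℝ) (S : Matrix (Fin n) (Fin n) ℝ) :
    Matrix (Fin n) (Fin n) ℝ :=
  S - (a ⬝ᵥ (S *ᵥ a) + v)⁻¹ • Matrix.vecMulVec (S *ᵥ a) (a ᵥ* S)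

/-- The Joseph form of the covariance update. -/
lemma covUpdate_eq_joseph (v : ℝ) {a : Fin n → ℝ} (ha : a ⬝ᵥ a = 1)
    {S : Matrix (Fin n) (Fin n) ℝ} (hS : S.IsHermitian) :
    covUpdate v a S =
      (1 - Matrix.vecMulVec (gain v a S) a) * S * (1 - Matrix.vecMulVec (gain v a S) a)ᵀ +
        (-Matrix.vecMulVec (gain v a S) a) * (v • (1 : Matrix (Fin n) (Fin n) ℝ)) *
          (-Matrix.vecMulVec (gain v a S) a)ᵀ := by
  have hs := vecMul_eq_mulVec_of_isHermitian hS a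
  set b := S *ᵥ a with hb
  set c := a ⬝ᵥ b + v with hc
  have hg : gain v a S = c⁻¹ • b := rfl
  -- The gain denominator may vanish; the identity survives because `0⁻¹ = 0`.
  have hcc : c⁻¹ * c⁻¹ * c = c⁻¹ := by
    by_cases h : c = 0
    · simp [h]
    · field_simp
  have key : c⁻¹ * c⁻¹ * (a ⬝ᵥ b) + c⁻¹ * c⁻¹ * v = c⁻¹ := by rw [← mul_add, ← hc, hcc]
  rw [hg, covUpdate, ← hb, ← hc, hs]
  simp only [Matrix.transpose_sub, Matrix.transpose_one, Matrix.transpose_neg,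
    Matrix.transpose_smul, Matrix.transpose_vecMulVec, sub_mul, mul_sub, one_mul, mul_one, Matrix.vecMulVec_mul,
    Matrix.mul_vecMulVec, hs, ← hb, Matrix.smul_vecMulVec, neg_mul,
    mul_neg, neg_neg, Matrix.mul_smul, Matrix.smul_mul, Matrix.smul_mulVec,
    Matrix.vecMulVec_mulVec]
  ext i j
  simp only [Matrix.sub_apply, Matrix.add_apply, Matrix.smul_apply, Matrix.vecMulVec_apply,
    smul_eq_mul, dotProduct_comm b a, ha,
    op_smul_eq_mul]
  linear_combination (-(b i * b j)) * key

lemma covUpdate_posSemidef {v : ℝ} (hv : 0 ≤ v) {a : Fin n → ℝ} (ha : a ⬝ᵥ a = 1)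
    {S : Matrix (Fin n) (Fin n) ℝ} (hS : S.PosSemidef) : (covUpdate v a S).PosSemidef := by
  rw [covUpdate_eq_joseph v ha hS.isHermitian]
  simp only [← Matrix.conjTranspose_eq_transpose_of_trivial]
  exact (hS.mul_mul_conjTranspose_same _).add
    ((Matrix.PosSemidef.one.smul hv).mul_mul_conjTranspose_same _)

lemma covUpdate_eq_sub_smul (v : ℝ) {a : Fin n → ℝ} (ha : a ⬝ᵥ a = 1)
    {S : Matrix (Fin n) (Fin n) ℝ} (hS : S.IsHermitian) {l : ℝ} (hl : S *ᵥ a = l • a) :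
    covUpdate v a S = S - (l ^ 2 / (l + v)) • Matrix.vecMulVec a a := by
  rw [covUpdate, vecMul_eq_mulVec_of_isHermitian hS, hl, dotProduct_smul, ha,
    Matrix.smul_vecMulVec, Matrix.vecMulVec_smul, smul_smul, smul_smul, smul_eq_mul, mul_one]
  congr 2
  ring

/-- The covariance after `t` measurements, which does not depend on their outcomes. -/
noncomputable def covAfter (v : ℝ)
    (u : ℕ → Matrix (Fin n) (Fin n) ℝ → EuclideanSpace ℝ (Fin n))
    (S : Matrix (Fin n) (Fin n) ℝ) : ℕ → Matrix (Fin n) (Fin n) ℝ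
  | 0 => S
  | t + 1 => covUpdate v (u t (covAfter v u S t)).ofLp (covAfter v u S t)

lemma loop_cov (v : ℝ) (u : ℕ → Matrix (Fin n) (Fin n) ℝ → EuclideanSpace ℝ (Fin n))
    (obs : ℕ → EuclideanSpace ℝ (Fin n) → ℝ) (s₀ : State n) (t : ℕ) :
    (loop v u obs s₀ t).cov = covAfter v u s₀.cov t := by
  induction t with
  | zero => rfl
  | succ t ih =>
    rw [covAfter, ← ih]
    rfl

variable {v : ℝ} {u : ℕ → Matrix (Fin n) (Fin n) ℝ → EuclideanSpace ℝ (Fin n)}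
  {S : Matrix (Fin n) (Fin n) ℝ}

lemma covAfter_posSemidef (hv : 0 ≤ v) (hS : S.PosSemidef)
    (hu : ∀ t (M : Matrix (Fin n) (Fin n) ℝ), M.PosSemidef → IsTopEigenvector M (u t M)) (t : ℕ) :
    (covAfter v u S t).PosSemidef := by
  induction t with
  | zero => exact hS
  | succ t ih => exact covUpdate_posSemidef hv (dotProduct_self_of_norm_eq_one (hu t _ ih).1) ih

/-- If `f` drops by one at each reduction of an eigenvalue above `δ`, then the number of
measurements made while the spectral norm exceeds `δ` is bounded by the sum of `f` over the
eigenvalues. -/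
lemma le_spectralSum (hv : 0 ≤ v) (hS : S.PosSemidef)
    (hu : ∀ t (M : Matrix (Fin n) (Fin n) ℝ), M.PosSemidef → IsTopEigenvector M (u t M))
    {δ : ℝ} {f : ℝ → ℕ} (hf : ∀ l, δ < l → f (l - l ^ 2 / (l + v)) + 1 = f l) {t : ℕ}
    (ht : ∀ s < t, δ < specNorm (covAfter v u S s)) : t ≤ spectralSum f S := by
  -- The counter plus the number of measurements made is invariant.
  suffices h : spectralSum f (covAfter v u S t) + t = spectralSum f S by omega
  induction t with
  | zero => rfl
  | succ t ih =>
    have hP := covAfter_posSemidef hv hS hu t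
    have ha := dotProduct_self_of_norm_eq_one (hu t _ hP).1
    have hl := (hu t _ hP).2
    have h1 := spectralSum_sub_smul_vecMulVec_self f ha hl
      (specNorm (covAfter v u S t) ^ 2 / (specNorm (covAfter v u S t) + v))
    have h2 := hf _ (ht t (Nat.lt_succ_self t))
    rw [← covUpdate_eq_sub_smul v ha hP.isHermitian hl] at h1
    have h3 := ih fun s hs => ht s (hs.trans (Nat.lt_succ_self t))
    rw [covAfter]
    omega

end Covariance

/-! ### Counting reductions of one eigenvalue -/

section Counts

/-- The number of reductions which bring the eigenvalue `l` down to `δ`, for noise variance `v`. -/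
noncomputable def reductions (δ v l : ℝ) : ℕ :=
  if l = 0 then 0 else ⌈(δ⁻¹ - 1 / l) * v⌉.toNat

/-- The inverse eigenvalue grows by `1 / v`, so the argument of the ceiling falls by exactly 1; it
was positive, so `toNat` does not truncate. -/
lemma reductions_reduce {δ v l : ℝ} (hδ : 0 < δ) (hv : 0 < v) (hl : δ < l) :
    reductions δ v (l - l ^ 2 / (l + v)) + 1 = reductions δ v l := by
  have hl0 : 0 < l := hδ.trans hl
  have h1 : l - l ^ 2 / (l + v) = l * v / (l + v) := by
    have : l + v ≠ 0 := by positivity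
    field_simp
    ring
  have h2 : l * v / (l + v) ≠ 0 := by positivity
  have h3 : (δ⁻¹ - 1 / (l * v / (l + v))) * v = (δ⁻¹ - 1 / l) * v - 1 := by
    field_simp
    ring
  have h4 : 0 < (δ⁻¹ - 1 / l) * v := by
    refine mul_pos (sub_pos.2 ?_) hv
    rw [one_div]
    exact inv_strictAnti₀ hδ hl
  rw [reductions, reductions, h1, if_neg h2, if_neg hl0.ne', h3, Int.ceil_sub_one]
  have := Int.ceil_pos.2 h4
  omega

lemma reductions_eq_ite {δ v l : ℝ} (hδ : 0 < δ) (hv : 0 < v) (hvδ : v ≤ δ) (hl : 0 ≤ l) :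
    reductions δ v l = if δ < l then 1 else 0 := by
  -- The eigenvalue 0 is special: with `1 / 0 = 0` the ceiling formula would wrongly count one
  -- reduction.
  rcases hl.eq_or_lt with rfl | hl
  · simp [reductions, hδ.not_gt]
  rw [reductions, if_neg hl.ne']
  split_ifs with h
  · have h1 : ⌈(δ⁻¹ - 1 / l) * v⌉ = 1 := by
      rw [Int.ceil_eq_iff]
      have h2 : l⁻¹ < δ⁻¹ := inv_strictAnti₀ hδ h
      have h3 : δ⁻¹ * v ≤ 1 := by rwa [inv_mul_le_iff₀ hδ, mul_one]
      have h4 : 0 < l⁻¹ * v := by positivity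
      constructor
      · simpa using mul_pos (sub_pos.2 h2) hv
      · rw [one_div, sub_mul]
        push_cast
        linarith
    rw [h1]
    rfl
  · have h2 : δ⁻¹ ≤ l⁻¹ := inv_anti₀ hl (not_lt.1 h)
    have h3 : ⌈(δ⁻¹ - 1 / l) * v⌉ ≤ 0 := by
      rw [Int.ceil_le, one_div]
      simpa using mul_nonpos_of_nonpos_of_nonneg (sub_nonpos.2 h2) hv.le
    exact Int.toNat_of_nonpos h3

/-- The new eigenvalue `l * v / (l + v)` is at most `v ≤ δ`. This also covers `v = 0`. -/
lemma indicator_reduce {δ v l : ℝ} (hδ : 0 < δ) (hv : 0 ≤ v) (hvδ : v ≤ δ) (hl : δ < l) :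
    (if δ < l - l ^ 2 / (l + v) then 1 else 0) + 1 = if δ < l then 1 else 0 := by
  have hl0 : 0 < l := hδ.trans hl
  have h : l - l ^ 2 / (l + v) ≤ δ := by
    have h1 : l - l ^ 2 / (l + v) = l * v / (l + v) := by
      have : l + v ≠ 0 := by positivity
      field_simp
      ring
    rw [h1, div_le_iff₀ (by positivity)]
    nlinarith
  rw [if_neg h.not_gt, if_pos hl]

variable {n : ℕ} {σ ε p : ℝ}

lemma noisyCount_eq_sum_reductions (eig : Fin n → ℝ) :
    noisyCount σ ε p eig = ((∑ i, reductions (threshold n ε p) (σ ^ 2) (eig i) : ℕ) : ℤ) := by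
  rw [noisyCount, Finset.sum_filter, Nat.cast_sum]
  refine Finset.sum_congr rfl fun i _ => ?_
  rw [reductions, threshold, inv_div]
  by_cases h : eig i = 0
  · simp [h]
  · simp [h, max_comm]

lemma exactCount_eq_sum_ite (eig : Fin n → ℝ) :
    exactCount ε p eig = ∑ i, if threshold n ε p < eig i then 1 else 0 := by
  rw [exactCount, Finset.card_filter]

end Counts

end InfoGreedy

namespace InfoGreedy

/-! ### The chi-squared law and its quantile -/

section ChiSq

instance isProbabilityMeasure_chiSq (n : ℕ) : IsProbabilityMeasure (chiSq n) :=
  Measure.isProbabilityMeasure_map (Measurable.aemeasurable (by fun_prop))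

/-- The chi-squared distribution has no atoms. -/
lemma chiSq_singleton {n : ℕ} (hn : 0 < n) (t : ℝ) : chiSq n {t} = 0 := by
  obtain ⟨m, rfl⟩ := Nat.exists_eq_succ_of_ne_zero hn.ne'
  have hmeas : MeasurableSet {q : ℝ × (Fin m → ℝ) | q.1 ^ 2 + ∑ i, q.2 i ^ 2 = t} :=
    (measurableSet_singleton t).preimage
      (show Measurable fun q : ℝ × (Fin m → ℝ) => q.1 ^ 2 + ∑ i, q.2 i ^ 2 by fun_prop)
  have hpres := measurePreserving_piFinSuccAbove
    (fun _ : Fin (m + 1) => gaussianReal 0 1) (0 : Fin (m + 1))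
  have hset : (fun z : Fin (m + 1) → ℝ => ∑ i, z i ^ 2) ⁻¹' {t} =
      MeasurableEquiv.piFinSuccAbove (fun _ : Fin (m + 1) => ℝ) 0 ⁻¹'
        {q : ℝ × (Fin m → ℝ) | q.1 ^ 2 + ∑ i, q.2 i ^ 2 = t} := by
    ext z
    simp [Fin.sum_univ_succ, MeasurableEquiv.piFinSuccAbove, Fin.insertNthEquiv, Fin.tail]
  rw [chiSq, Measure.map_apply (by fun_prop) (measurableSet_singleton t), hset,
    hpres.measure_preimage hmeas.nullMeasurableSet, Measure.prod_apply_symm hmeas]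
  refine (lintegral_congr fun y => ?_).trans lintegral_zero
  have : NullSingletonClass (gaussianReal 0 1) := nullSingletonClass_gaussianReal one_ne_zero
  change gaussianReal 0 1 _ = 0
  -- Once the other coordinates are fixed, the first has at most two possible values.
  refine measure_mono_null (t := {√(t - ∑ i, y i ^ 2), -√(t - ∑ i, y i ^ 2)}) (fun s hs => ?_)
    (Set.Finite.measure_zero (Set.toFinite _) _)
  have hs' : s ^ 2 = t - ∑ i, y i ^ 2 := eq_sub_of_add_eq hs
  refine sq_eq_sq_iff_eq_or_eq_neg.1 ?_
  rw [Real.sq_sqrt (hs' ▸ sq_nonneg s), hs']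

lemma cdf_chiSq_zero {n : ℕ} (hn : 0 < n) : cdf (chiSq n) 0 = 0 := by
  rw [cdf_eq_real, measureReal_def, ENNReal.toReal_eq_zero_iff]
  left
  refine measure_mono_null (t := {0} ∪ Set.Iio 0) (fun x hx => ?_)
    (measure_union_null (chiSq_singleton hn 0) ?_)
  · exact (le_iff_eq_or_lt.1 hx)
  · rw [chiSq, Measure.map_apply (by fun_prop) measurableSet_Iio]
    refine (congrArg _ (Set.eq_empty_of_forall_notMem fun z hz => ?_)).trans measure_empty
    exact (Finset.sum_nonneg fun i _ => sq_nonneg (z i)).not_gt hz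

variable {n : ℕ} {p : ℝ}

/-- The infimum defining the quantile is attained by right continuity of the cdf; `0 < p` bounds the
set below and `p < 1` makes it nonempty. -/
lemma le_cdf_chiSqQuantile (hn : 0 < n) (hp₀ : 0 < p) (hp₁ : p < 1) :
    p ≤ cdf (chiSq n) (chiSqQuantile n p) := by
  have hbdd : BddBelow {t : ℝ | p ≤ cdf (chiSq n) t} := ⟨0, fun t ht => by
    by_contra! h
    exact absurd (ht.trans (monotone_cdf _ h.le)) (by rw [cdf_chiSq_zero hn]; exact hp₀.not_ge)⟩
  have hne : {t : ℝ | p ≤ cdf (chiSq n) t}.Nonempty :=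
    ((tendsto_cdf_atTop (chiSq n)).eventually (eventually_ge_nhds hp₁)).exists
  refine ge_of_tendsto (((cdf (chiSq n)).right_continuous _).mono_left
    (nhdsWithin_mono _ Set.Ioi_subset_Ici_self)) ?_
  filter_upwards [self_mem_nhdsWithin] with y hy
  obtain ⟨s, hs, hsy⟩ := (csInf_lt_iff hbdd hne).1 (show sInf _ < y from hy)
  exact le_trans hs (monotone_cdf _ hsy.le)

lemma chiSqQuantile_pos (hn : 0 < n) (hp₀ : 0 < p) (hp₁ : p < 1) : 0 < chiSqQuantile n p := by
  by_contra! h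
  have := (le_cdf_chiSqQuantile hn hp₀ hp₁).trans (monotone_cdf _ h)
  rw [cdf_chiSq_zero hn] at this
  exact this.not_gt hp₀

lemma threshold_pos (hn : 0 < n) (hp₀ : 0 < p) (hp₁ : p < 1) {ε : ℝ} (hε : 0 < ε) :
    0 < threshold n ε p :=
  div_pos (pow_pos hε 2) (chiSqQuantile_pos hn hp₀ hp₁)

/-- Absence of atoms turns `≤` into `<`, which the strict bound on the error requires. -/
lemma le_stdGaussian_norm_sq_lt (hn : 0 < n) (hp₀ : 0 < p) (hp₁ : p < 1) :
    p ≤ (stdGaussian (EuclideanSpace ℝ (Fin n))).real {z | ‖z‖ ^ 2 < chiSqQuantile n p} := by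
  have h1 : (stdGaussian (EuclideanSpace ℝ (Fin n))).real {z | ‖z‖ ^ 2 < chiSqQuantile n p} =
      (chiSq n).real (Set.Iio (chiSqQuantile n p)) := by
    rw [← map_pi_eq_stdGaussian, chiSq, map_measureReal_apply (by fun_prop) measurableSet_Iio,
      map_measureReal_apply (by fun_prop) (measurableSet_lt (by fun_prop) (by fun_prop))]
    congr 1
    ext z
    simp [EuclideanSpace.real_norm_sq_eq]
  have h2 : (chiSq n).real (Set.Iic (chiSqQuantile n p)) ≤
      (chiSq n).real (Set.Iio (chiSqQuantile n p)) := by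
    rw [← Set.Iio_union_right]
    refine (measureReal_union_le _ _).trans_eq ?_
    rw [measureReal_def _ {_}, chiSq_singleton hn, ENNReal.toReal_zero, add_zero]
  rw [h1]
  exact ((le_cdf_chiSqQuantile hn hp₀ hp₁).trans_eq (cdf_eq_real _ _)).trans h2

end ChiSq

/-! ### Gaussian vectors: concentration and linear images -/

section Gaussian

variable {n : ℕ}

open scoped MatrixOrder in
lemma norm_sq_toEuclideanCLM_sqrt_le {S : Matrix (Fin n) (Fin n) ℝ} (hS : S.PosSemidef)
    (z : EuclideanSpace ℝ (Fin n)) :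
    ‖Matrix.toEuclideanCLM (𝕜 := ℝ) (CFC.sqrt S) z‖ ^ 2 ≤ specNorm S * ‖z‖ ^ 2 := by
  have hsa : IsSelfAdjoint (Matrix.toEuclideanCLM (n := Fin n) (𝕜 := ℝ) (CFC.sqrt S)) :=
    (CFC.sqrt_nonneg S).isSelfAdjoint.map _
  have h : ‖Matrix.toEuclideanCLM (𝕜 := ℝ) (CFC.sqrt S) z‖ ^ 2 =
      inner ℝ z (Matrix.toEuclideanCLM (𝕜 := ℝ) S z) := by
    rw [← real_inner_self_eq_norm_sq, ← ContinuousLinearMap.adjoint_inner_right, hsa.adjoint_eq,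
      ← ContinuousLinearMap.comp_apply, ← ContinuousLinearMap.mul_def, ← map_mul,
      CFC.sqrt_mul_sqrt_self _ hS.nonneg]
  rw [h]
  refine (real_inner_le_norm _ _).trans ?_
  calc ‖z‖ * ‖Matrix.toEuclideanCLM (𝕜 := ℝ) S z‖ ≤ ‖z‖ * (specNorm S * ‖z‖) := by
        gcongr
        exact ContinuousLinearMap.le_opNorm _ _
    _ = specNorm S * ‖z‖ ^ 2 := by ring

open scoped MatrixOrder in
/-- A centred Gaussian vector whose covariance has spectral norm at most `ε² / χ²_n(p)` lies in
the ball of radius `ε` with probability at least `p`. -/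
lemma le_multivariateGaussian_norm_lt (hn : 0 < n) {S : Matrix (Fin n) (Fin n) ℝ}
    (hS : S.PosSemidef) {ε p : ℝ} (hε : 0 < ε) (hp₀ : 0 < p) (hp₁ : p < 1)
    (h : specNorm S ≤ threshold n ε p) :
    p ≤ (multivariateGaussian 0 S).real {e | ‖e‖ < ε} := by
  refine (le_stdGaussian_norm_sq_lt hn hp₀ hp₁).trans ?_
  rw [multivariateGaussian, map_measureReal_apply (by fun_prop)
    (measurableSet_lt (by fun_prop) (by fun_prop))]
  refine measureReal_mono fun z hz => ?_
  have hz' : ‖z‖ ^ 2 < chiSqQuantile n p := hz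
  have hq := chiSqQuantile_pos hn hp₀ hp₁
  simp only [Set.mem_preimage, Set.mem_ofPred_eq, zero_add]
  refine lt_of_pow_lt_pow_left₀ 2 hε.le ?_
  calc ‖Matrix.toEuclideanCLM (𝕜 := ℝ) (CFC.sqrt S) z‖ ^ 2 ≤ specNorm S * ‖z‖ ^ 2 :=
        norm_sq_toEuclideanCLM_sqrt_le hS z
    _ ≤ threshold n ε p * ‖z‖ ^ 2 := by gcongr
    _ < threshold n ε p * chiSqQuantile n p := by
        gcongr
        exact threshold_pos hn hp₀ hp₁ hε
    _ = ε ^ 2 := div_mul_cancel₀ _ hq.ne'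

lemma map_toEuclideanCLM_multivariateGaussian {S : Matrix (Fin n) (Fin n) ℝ} (hS : S.PosSemidef)
    (A : Matrix (Fin n) (Fin n) ℝ) :
    (multivariateGaussian 0 S).map (Matrix.toEuclideanCLM (𝕜 := ℝ) A) =
      multivariateGaussian 0 (A * S * Aᵀ) := by
  have hS' : (A * S * Aᵀ).PosSemidef := by
    rw [← Matrix.conjTranspose_eq_transpose_of_trivial]
    exact hS.mul_mul_conjTranspose_same _
  refine Measure.ext_of_charFun (funext fun t => ?_)
  have h : charFun ((multivariateGaussian 0 S).map (Matrix.toEuclideanCLM (𝕜 := ℝ) A)) t =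
      charFun (multivariateGaussian 0 S) (Matrix.toEuclideanCLM (𝕜 := ℝ) Aᵀ t) := by
    rw [charFun_apply, charFun_apply, integral_map (by fun_prop) (by fun_prop)]
    congr with z
    rw [real_inner_comm, Matrix.inner_toEuclideanCLM, real_inner_comm,
      ← real_inner_comm, Matrix.inner_toEuclideanCLM, Matrix.mulVec_transpose,
      dotProduct_comm z.ofLp, Matrix.dotProduct_mulVec]
  rw [h, charFun_multivariateGaussian hS, charFun_multivariateGaussian hS', inner_zero_right,
    inner_zero_right, Matrix.ofLp_toEuclideanCLM, ← Matrix.mulVec_mulVec, ← Matrix.mulVec_mulVec,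
    Matrix.dotProduct_mulVec t.ofLp, Matrix.mulVec_transpose]

/-- The law of a linear combination of independent centred Gaussian vectors. -/
lemma hasLaw_toEuclideanCLM_add {Ω : Type*} [MeasurableSpace Ω] {P : Measure Ω}
    [IsProbabilityMeasure P] {S R : Matrix (Fin n) (Fin n) ℝ} (hS : S.PosSemidef)
    (hR : R.PosSemidef) {e w : Ω → EuclideanSpace ℝ (Fin n)}
    (he : HasLaw e (multivariateGaussian 0 S) P) (hw : HasLaw w (multivariateGaussian 0 R) P)
    (hew : IndepFun e w P) (A B : Matrix (Fin n) (Fin n) ℝ) :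
    HasLaw (fun ω => Matrix.toEuclideanCLM (𝕜 := ℝ) A (e ω) +
        Matrix.toEuclideanCLM (𝕜 := ℝ) B (w ω))
      (multivariateGaussian 0 (A * S * Aᵀ + B * R * Bᵀ)) P := by
  have hA : Measurable (Matrix.toEuclideanCLM (n := Fin n) (𝕜 := ℝ) A) := by fun_prop
  have hB : Measurable (Matrix.toEuclideanCLM (n := Fin n) (𝕜 := ℝ) B) := by fun_prop
  have hS' : (A * S * Aᵀ).PosSemidef := by
    rw [← Matrix.conjTranspose_eq_transpose_of_trivial]
    exact hS.mul_mul_conjTranspose_same _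
  have hR' : (B * R * Bᵀ).PosSemidef := by
    rw [← Matrix.conjTranspose_eq_transpose_of_trivial]
    exact hR.mul_mul_conjTranspose_same _
  have he' : P.map (fun ω => Matrix.toEuclideanCLM (𝕜 := ℝ) A (e ω)) =
      multivariateGaussian 0 (A * S * Aᵀ) := by
    rw [← map_toEuclideanCLM_multivariateGaussian hS, ← he.map_eq,
      AEMeasurable.map_map_of_aemeasurable hA.aemeasurable he.aemeasurable]
    rfl
  have hw' : P.map (fun ω => Matrix.toEuclideanCLM (𝕜 := ℝ) B (w ω)) =
      multivariateGaussian 0 (B * R * Bᵀ) := by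
    rw [← map_toEuclideanCLM_multivariateGaussian hR, ← hw.map_eq,
      AEMeasurable.map_map_of_aemeasurable hB.aemeasurable hw.aemeasurable]
    rfl
  have hae := hA.comp_aemeasurable he.aemeasurable
  have haw := hB.comp_aemeasurable hw.aemeasurable
  refine ⟨hae.add haw, ?_⟩
  have : IsProbabilityMeasure (P.map fun ω => Matrix.toEuclideanCLM (𝕜 := ℝ) A (e ω) +
        Matrix.toEuclideanCLM (𝕜 := ℝ) B (w ω)) := Measure.isProbabilityMeasure_map (hae.add haw)
  refine Measure.ext_of_charFun (funext fun t => ?_)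
  have hadd := congrFun ((hew.comp hA hB).charFun_map_fun_add_eq_mul hae haw) t
  simp only [Pi.mul_apply, Function.comp_def] at hadd
  rw [hadd, he', hw', charFun_multivariateGaussian hS', charFun_multivariateGaussian hR',
    charFun_multivariateGaussian (hS'.add hR'), ← Complex.exp_add, Matrix.add_mulVec,
    dotProduct_add]
  simp only [inner_zero_right, Complex.ofReal_zero, Complex.ofReal_add]
  ring_nf

end Gaussian

/-! ### Independence of past and present noise -/

section Independence

variable {Ω α β γ : Type*} [MeasurableSpace Ω] [MeasurableSpace α] [MeasurableSpace β]
  [MeasurableSpace γ] {P : Measure Ω} [IsProbabilityMeasure P]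

lemma indepFun_prodMk_of_indepFun {f : Ω → α} {g : Ω → β} {h : Ω → γ} (hf : AEMeasurable f P)
    (hg : AEMeasurable g P) (hh : AEMeasurable h P) (hfgh : IndepFun f (fun ω => (g ω, h ω)) P)
    (hgh : IndepFun g h P) : IndepFun (fun ω => (f ω, g ω)) h P := by
  have hfg : IndepFun f g P := hfgh.comp measurable_id measurable_fst
  rw [indepFun_iff_map_prod_eq_prod_map_map (hf.prodMk hg) hh,
    (indepFun_iff_map_prod_eq_prod_map_map hf hg).1 hfg]
  -- Up to reassociation, both sides are the triple product of the marginal laws.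
  apply (MeasurableEquiv.prodAssoc (α := α) (β := β) (γ := γ)).map_measurableEquiv_injective
  rw [Measure.prodAssoc_prod, ← (indepFun_iff_map_prod_eq_prod_map_map hg hh).1 hgh,
    ← (indepFun_iff_map_prod_eq_prod_map_map hf (hg.prodMk hh)).1 hfgh,
    AEMeasurable.map_map_of_aemeasurable
      MeasurableEquiv.prodAssoc.measurable.aemeasurable ((hf.prodMk hg).prodMk hh)]
  rfl

/-- The signal and the past noise are independent of the present noise. -/
lemma indepFun_past {x : Ω → α} {w : ℕ → Ω → β} (hx : AEMeasurable x P)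
    (hw : ∀ t, AEMeasurable (w t) P) (hww : iIndepFun w P)
    (hxw : IndepFun x (fun ω t => w t ω) P) (t : ℕ) :
    IndepFun (fun ω => (x ω, fun i : Finset.range t => w i ω)) (w t) P := by
  have hpast : AEMeasurable (fun ω => fun i : Finset.range t => w i ω) P :=
    aemeasurable_pi_lambda _ fun i => hw i
  refine indepFun_prodMk_of_indepFun hx hpast (hw t) ?_ ?_
  · exact hxw.comp measurable_id
      (show Measurable fun y : ℕ → β => ((fun i : Finset.range t => y i), y t) by fun_prop)
  · exact (hww.indepFun_finset₀ (Finset.range t) {t} (by simp) hw).comp measurable_id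
      (measurable_pi_apply (⟨t, Finset.mem_singleton_self t⟩ : ({t} : Finset ℕ)))

end Independence

/-! ### The law of the estimation error -/

section ErrorLaw

variable {n : ℕ} {σ : ℝ} {u : ℕ → Matrix (Fin n) (Fin n) ℝ → EuclideanSpace ℝ (Fin n)}
  {μ : EuclideanSpace ℝ (Fin n)} {S : Matrix (Fin n) (Fin n) ℝ}

lemma run_cov (x : EuclideanSpace ℝ (Fin n)) (w : ℕ → EuclideanSpace ℝ (Fin n)) (t : ℕ) :
    (run σ u μ S x w t).cov = covAfter (σ ^ 2) u S t :=
  loop_cov _ _ _ _ _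

lemma run_mean_succ (x : EuclideanSpace ℝ (Fin n)) (w : ℕ → EuclideanSpace ℝ (Fin n)) (t : ℕ) :
    (run σ u μ S x w (t + 1)).mean = (run σ u μ S x w t).mean +
      inner ℝ (u t (covAfter (σ ^ 2) u S t)) (x + w t - (run σ u μ S x w t).mean) •
        WithLp.toLp 2 (gain (σ ^ 2) (u t (covAfter (σ ^ 2) u S t)).ofLp
          (covAfter (σ ^ 2) u S t)) := by
  have h : run σ u μ S x w (t + 1) = (run σ u μ S x w t).update (σ ^ 2)
    (u t (run σ u μ S x w t).cov) (noiseFolding x w t (u t (run σ u μ S x w t).cov)) := rfl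
  rw [h, State.update, noiseFolding, run_cov, gain, WithLp.toLp_smul, smul_smul, mul_comm,
    ← inner_sub_right]

lemma toEuclideanCLM_vecMulVec (k a z : EuclideanSpace ℝ (Fin n)) :
    Matrix.toEuclideanCLM (𝕜 := ℝ) (Matrix.vecMulVec k.ofLp a.ofLp) z = (inner ℝ a z : ℝ) • k := by
  ext i
  simp [Matrix.ofLp_toEuclideanCLM, Matrix.vecMulVec_mulVec, PiLp.inner_apply, dotProduct,
    mul_comm]

/-- The recursion for the estimation error. -/
lemma run_error_succ (x : EuclideanSpace ℝ (Fin n)) (w : ℕ → EuclideanSpace ℝ (Fin n)) (t : ℕ) :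
    let a := (u t (covAfter (σ ^ 2) u S t)).ofLp
    let k := gain (σ ^ 2) a (covAfter (σ ^ 2) u S t)
    x - (run σ u μ S x w (t + 1)).mean =
      Matrix.toEuclideanCLM (𝕜 := ℝ) (1 - Matrix.vecMulVec k a)
          (x - (run σ u μ S x w t).mean) +
        Matrix.toEuclideanCLM (𝕜 := ℝ) (-Matrix.vecMulVec k a) (w t) := by
  intro a k
  have h := toEuclideanCLM_vecMulVec (WithLp.toLp 2 k) (u t (covAfter (σ ^ 2) u S t))
  simp only at h
  rw [run_mean_succ, map_sub Matrix.toEuclideanCLM, map_one, map_neg, sub_apply,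
    neg_apply, one_apply_eq_self, h, h, add_sub_right_comm,
    inner_add_right, add_smul]
  abel

/-- The error before measurement `t` involves only the signal and the noise with index below `t`;
this is what makes it independent of `w t`. -/
lemma exists_measurable_run_error (t : ℕ) :
    ∃ φ : EuclideanSpace ℝ (Fin n) × (Finset.range t → EuclideanSpace ℝ (Fin n)) →
        EuclideanSpace ℝ (Fin n), Measurable φ ∧
      ∀ x w, x - (run σ u μ S x w t).mean = φ (x, fun i => w i) := by
  induction t with
  | zero => exact ⟨fun q => q.1 - μ, by fun_prop, fun x w => rfl⟩
  | succ t ih =>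
    obtain ⟨φ, hφ, h⟩ := ih
    set a := (u t (covAfter (σ ^ 2) u S t)).ofLp
    set k := gain (σ ^ 2) a (covAfter (σ ^ 2) u S t)
    refine ⟨fun q => Matrix.toEuclideanCLM (𝕜 := ℝ) (1 - Matrix.vecMulVec k a)
        (φ (q.1, fun i => q.2 ⟨i, Finset.range_subset_range.2 t.le_succ i.2⟩)) +
      Matrix.toEuclideanCLM (𝕜 := ℝ) (-Matrix.vecMulVec k a)
        (q.2 ⟨t, Finset.self_mem_range_succ t⟩), by fun_prop, fun x w => ?_⟩
    rw [run_error_succ, h]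

/-- After `t` measurements the estimation error is a centred Gaussian vector whose covariance is
the current covariance of the algorithm. -/
lemma hasLaw_run_error {Ω : Type*} [MeasurableSpace Ω] {P : Measure Ω} [IsProbabilityMeasure P]
    (hS : S.PosSemidef) {x : Ω → EuclideanSpace ℝ (Fin n)}
    (hx : HasLaw x (multivariateGaussian μ S) P) {w : ℕ → Ω → EuclideanSpace ℝ (Fin n)}
    (hw : ∀ t, HasLaw (w t)
      (multivariateGaussian 0 (σ ^ 2 • (1 : Matrix (Fin n) (Fin n) ℝ))) P)
    (hww : iIndepFun w P) (hxw : IndepFun x (fun ω t => w t ω) P)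
    (hu : ∀ t (M : Matrix (Fin n) (Fin n) ℝ), M.PosSemidef → IsTopEigenvector M (u t M))
    (t : ℕ) :
    HasLaw (fun ω => x ω - (run σ u μ S (x ω) (fun t => w t ω) t).mean)
      (multivariateGaussian 0 (covAfter (σ ^ 2) u S t)) P := by
  induction t with
  | zero =>
    refine ⟨hx.aemeasurable.sub_const μ, ?_⟩
    have h : (fun ω => x ω - (run σ u μ S (x ω) (fun t => w t ω) 0).mean) =
      (fun y => y - μ) ∘ x := rfl
    rw [h, ← AEMeasurable.map_map_of_aemeasurable (by fun_prop) hx.aemeasurable, hx.map_eq,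
      multivariateGaussian, Measure.map_map (by fun_prop) (by fun_prop), multivariateGaussian]
    congr 1
    ext1 z
    simp [covAfter]
  | succ t ih =>
    have hP := covAfter_posSemidef (sq_nonneg σ) hS hu t
    have ha := dotProduct_self_of_norm_eq_one (hu t _ hP).1
    obtain ⟨φ, hφ, h⟩ := exists_measurable_run_error (σ := σ) (u := u) (μ := μ) (S := S) t
    have hind : IndepFun (fun ω => x ω - (run σ u μ S (x ω) (fun t => w t ω) t).mean) (w t) P := by
      simp only [h]
      exact (indepFun_past hx.aemeasurable (fun s => (hw s).aemeasurable) hww hxw t).comp hφ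
        measurable_id
    have key := hasLaw_toEuclideanCLM_add hP (Matrix.PosSemidef.one.smul (sq_nonneg σ)) ih (hw t)
      hind
      (1 - Matrix.vecMulVec (gain (σ ^ 2) (u t (covAfter (σ ^ 2) u S t)).ofLp
        (covAfter (σ ^ 2) u S t)) (u t (covAfter (σ ^ 2) u S t)).ofLp)
      (-Matrix.vecMulVec (gain (σ ^ 2) (u t (covAfter (σ ^ 2) u S t)).ofLp
        (covAfter (σ ^ 2) u S t)) (u t (covAfter (σ ^ 2) u S t)).ofLp)
    rw [← covUpdate_eq_joseph (σ ^ 2) ha hP.isHermitian] at key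
    simp only [run_error_succ]
    exact key

end ErrorLaw

end InfoGreedy

/-! ### Termination and the main theorem -/

namespace InfoGreedy

variable {n : ℕ} {v δ : ℝ} {u : ℕ → Matrix (Fin n) (Fin n) ℝ → EuclideanSpace ℝ (Fin n)}
  {S : Matrix (Fin n) (Fin n) ℝ}

/-- A run that never stopped would make more measurements than its counter allows. The counter is
the indicator of `δ < l` for `v = 0` and `reductions` for `v > 0`. -/
lemma exists_specNorm_covAfter_le (hv : 0 ≤ v) (hδ : 0 < δ) (hS : S.PosSemidef)
    (hu : ∀ t (M : Matrix (Fin n) (Fin n) ℝ), M.PosSemidef → IsTopEigenvector M (u t M)) :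
    ∃ t, specNorm (covAfter v u S t) ≤ δ := by
  by_contra! h
  have hle : ∀ f : ℝ → ℕ, ¬ ∀ l, δ < l → f (l - l ^ 2 / (l + v)) + 1 = f l := fun f hf =>
    (Nat.lt_succ_self _).not_ge
      (le_spectralSum hv hS hu hf (t := spectralSum f S + 1) fun s _ => h s)
  rcases hv.eq_or_lt with rfl | hv
  · exact hle (fun l => if δ < l then 1 else 0) fun l => indicator_reduce hδ le_rfl hδ.le
  · exact hle _ fun l => reductions_reduce hδ hv

end InfoGreedy

theorem mainTheorem5 {Ω : Type*} [MeasurableSpace Ω] (P : Measure Ω) [IsProbabilityMeasure P]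
    (n : ℕ) (hn : 0 < n)
    (μ : EuclideanSpace ℝ (Fin n)) (S : Matrix (Fin n) (Fin n) ℝ) (hS : S.PosSemidef)
    (σ ε p : ℝ) (hσ : 0 ≤ σ) (hε : 0 < ε) (hp₀ : 0 < p) (hp₁ : p < 1)
    -- the signal
    (x : Ω → EuclideanSpace ℝ (Fin n)) (hx : HasLaw x (multivariateGaussian μ S) P)
    -- the noise vectors, one for each measurement
    (w : ℕ → Ω → EuclideanSpace ℝ (Fin n))
    (hw : ∀ t, HasLaw (w t)
      (multivariateGaussian 0 (σ ^ 2 • (1 : Matrix (Fin n) (Fin n) ℝ))) P)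
    (hww : iIndepFun w P) (hxw : IndepFun x (fun ω t => w t ω) P)
    -- any rule by which the algorithm picks a unit eigenvector for the largest eigenvalue
    (u : ℕ → Matrix (Fin n) (Fin n) ℝ → EuclideanSpace ℝ (Fin n))
    (hu : ∀ t (M : Matrix (Fin n) (Fin n) ℝ), M.PosSemidef →
      InfoGreedy.IsTopEigenvector M (u t M)) :
    ∃ T : ℕ,
      -- the algorithm stops after `T` measurements, all made with unit vectors
      (∀ ω, InfoGreedy.StopsAfter (InfoGreedy.threshold n ε p)
        (InfoGreedy.run σ u μ S (x ω) (fun t => w t ω)) T) ∧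
      (∀ ω, ∀ t < T, ‖u t (InfoGreedy.run σ u μ S (x ω) (fun t => w t ω) t).cov‖ = 1) ∧
      -- the bounds on the number of measurements
      (0 < σ → (T : ℤ) ≤ InfoGreedy.noisyCount σ ε p hS.isHermitian.eigenvalues) ∧
      (σ ^ 2 ≤ InfoGreedy.threshold n ε p →
        T ≤ InfoGreedy.exactCount ε p hS.isHermitian.eigenvalues) ∧
      (0 < σ → σ ^ 2 ≤ InfoGreedy.threshold n ε p →
        InfoGreedy.noisyCount σ ε p hS.isHermitian.eigenvalues =
          InfoGreedy.exactCount ε p hS.isHermitian.eigenvalues) ∧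
      -- the accuracy of the returned mean
      p ≤ P.real {ω | ‖x ω - (InfoGreedy.run σ u μ S (x ω) (fun t => w t ω) T).mean‖ < ε} := by
  classical
  set δ := InfoGreedy.threshold n ε p
  have hδ : 0 < δ := InfoGreedy.threshold_pos hn hp₀ hp₁ hε
  have hv : 0 ≤ σ ^ 2 := sq_nonneg σ
  -- `T` is read off from `covAfter`, so one value serves every `ω`.
  have hex := InfoGreedy.exists_specNorm_covAfter_le hv hδ hS hu
  have hbefore : ∀ s < Nat.find hex,
      δ < InfoGreedy.specNorm (InfoGreedy.covAfter (σ ^ 2) u S s) :=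
    fun s hs => not_le.1 (Nat.find_min hex hs)
  refine ⟨Nat.find hex, fun ω => ⟨?_, fun t ht => ?_⟩, fun ω t _ => ?_, fun hσ₀ => ?_,
    fun hσδ => ?_, fun hσ₀ hσδ => ?_, ?_⟩
  · simpa only [Set.mem_ofPred_eq, InfoGreedy.run_cov] using Nat.find_spec hex
  · refine Nat.find_min' hex ?_
    simpa only [Set.mem_ofPred_eq, InfoGreedy.run_cov] using ht
  · rw [InfoGreedy.run_cov]
    exact (hu t _ (InfoGreedy.covAfter_posSemidef hv hS hu t)).1
  · rw [InfoGreedy.noisyCount_eq_sum_reductions, ← InfoGreedy.spectralSum_eq_sum_eigenvalues,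
      Nat.cast_le]
    exact InfoGreedy.le_spectralSum hv hS hu
      (fun l => InfoGreedy.reductions_reduce hδ (pow_pos hσ₀ 2)) hbefore
  · rw [InfoGreedy.exactCount_eq_sum_ite,
      ← InfoGreedy.spectralSum_eq_sum_eigenvalues (fun l => if δ < l then 1 else 0)]
    exact InfoGreedy.le_spectralSum hv hS hu
      (fun l => InfoGreedy.indicator_reduce hδ hv hσδ) hbefore
  · rw [InfoGreedy.noisyCount_eq_sum_reductions, InfoGreedy.exactCount_eq_sum_ite]
    exact congrArg _ (Finset.sum_congr rfl fun i _ =>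
      InfoGreedy.reductions_eq_ite hδ (pow_pos hσ₀ 2) hσδ (hS.eigenvalues_nonneg i))
  · rw [(InfoGreedy.hasLaw_run_error hS hx hw hww hxw hu (Nat.find hex)).measureReal_eq
      (p := fun e => ‖e‖ < ε) (measurableSet_lt (by fun_prop) (by fun_prop))]
    exact InfoGreedy.le_multivariateGaussian_norm_lt hn
      (InfoGreedy.covAfter_posSemidef hv hS hu _) hε hp₀ hp₁ (Nat.find_spec hex)
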